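/- Let $e_0,e_1$ be the standard basis of $\mathbb{C}^2$ and let $$|W_3\rangle = e_1\otimes e_0\otimes e_0+e_0\otimes e_1\otimes e_0+e_0\otimes e_0\otimes e_1\in(\mathbb{C}^2)^{\otimes 3}.$$ The tensor rank of a tensor $T\in(\mathbb{C}^2)^{\otimes d}$ is the smallest number $r$ such that $T$ is a sum of $r$ product tensors $x_1\otimes\cdots\otimes x_d$ with $x_1,\dots,x_d\in\mathbb{C}^2$. Then the six-qubit tensor $$|W_3\rangle^{\otimes 2}=|W_3\rangle\otimes|W_3\rangle\in(\mathbb{C}^2)^{\otimes 6},$$ regarded as a tensor with six factors $\mathbb{C}^2$, has tensor rank exactly $8$. -/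

import Mathlib

open scoped TensorProduct

/-- `r` product tensors suffice to write the tensor `T` as a linear combination:
`T = ∑_{l < r} a_l • (x_{l,1} ⊗ ⋯ ⊗ x_{l,d})`. -/
def HasProductDecomposition {K ι : Type*} [Field K] {V : ι → Type*}
    [∀ i, AddCommGroup (V i)] [∀ i, Module K (V i)]
    (T : PiTensorProduct K V) (r : ℕ) : Prop :=
  ∃ (a : Fin r → K) (x : Fin r → (i : ι) → V i),
    T = ∑ l, a l • PiTensorProduct.tprod K (x l)

/-- The tensor rank of `T`: the least number of product tensors in a decomposition of `T`.
(In a decomposition of least length no summand vanishes, so that every summand is a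
rank one tensor; the rank of the zero tensor is `0`.) -/
noncomputable def tensorRank {K ι : Type*} [Field K] {V : ι → Type*}
    [∀ i, AddCommGroup (V i)] [∀ i, Module K (V i)]
    (T : PiTensorProduct K V) : ℕ :=
  sInf {r : ℕ | HasProductDecomposition T r}

/-- Every tensor has a decomposition. -/
theorem exists_hasProductDecomposition {K ι : Type*} [Field K] {V : ι → Type*}
    [∀ i, AddCommGroup (V i)] [∀ i, Module K (V i)]
    (T : PiTensorProduct K V) : ∃ r, HasProductDecomposition T r := by
  have hT : T ∈ Submodule.span K (Set.range (PiTensorProduct.tprod K (s := V))) := by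
    rw [PiTensorProduct.span_tprod_eq_top]; trivial
  obtain ⟨n, f, g, h⟩ := Submodule.mem_span_set'.mp hT
  choose x hx using fun l => (g l).2
  refine ⟨n, f, x, ?_⟩
  simp only [hx, h]

/-- The infimum that defines the rank is a minimum. -/
theorem tensorRank_isLeast {K ι : Type*} [Field K] {V : ι → Type*}
    [∀ i, AddCommGroup (V i)] [∀ i, Module K (V i)]
    (T : PiTensorProduct K V) :
    IsLeast {r : ℕ | HasProductDecomposition T r} (tensorRank T) :=
  ⟨Nat.sInf_mem (exists_hasProductDecomposition T), fun _ hr => Nat.sInf_le hr⟩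

/-- The tensor `|W_d⟩ = ∑_j e₀ ⊗ ⋯ ⊗ e₀ ⊗ e₁ ⊗ e₀ ⊗ ⋯ ⊗ e₀` (with `e₁` in position `j`)
in the `d`-fold tensor power of `ℂ²`. -/
noncomputable def wTensor (d : ℕ) : ⨂[ℂ]^d (Fin 2 → ℂ) :=
  ∑ j : Fin d, PiTensorProduct.tprod ℂ
    (fun i : Fin d => if i = j then (Pi.single 1 1 : Fin 2 → ℂ) else Pi.single 0 1)

/-- The tensor product of an `m`-tensor and an `n`-tensor, viewed as an `(m + n)`-tensor. -/
noncomputable def outerProduct {m n : ℕ} (S : ⨂[ℂ]^m (Fin 2 → ℂ)) (T : ⨂[ℂ]^n (Fin 2 → ℂ)) :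
    ⨂[ℂ]^(m + n) (Fin 2 → ℂ) :=
  TensorPower.mulEquiv (S ⊗ₜ[ℂ] T)

/-! `wCoeff` is the form taking the coefficient of s in xyz on ℂ[s]/(s²), so W ⊗ W takes the
coefficient of st in xyz on A = ℂ[s,t]/(s²,t²). Each summand of a decomposition is a product of
three functionals α ⊗ α', β ⊗ β', γ ⊗ γ' on A.

Suppose seven summands suffice. For each choice of one of the first three factors and one of the
last three, take the summands whose two vectors both have nonzero coordinate 1, that is, whose
functional is nonzero at st (the support). These nine sets are nonempty (`exists_ne_zero`) and
pairwise disjoint (`eq_zero_of_support`), but 9 > 7.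

Disjointness rests on a substitution argument (`exists_basis`): some unit 1 + X is killed by three
of the functionals, and the at most four other summands must then give a basis of the dual of A.
Hence cutting the values of a nonunit down to a support gives the values of another nonunit
(`exists_split`), and the cuts on the α and γ sides are adjoint (`exists_adjoint_split`).

An explicit eight-term identity gives the upper bound. -/

/-! ### Decompositions in coordinates and their symmetries. -/

/-- The coordinates of the three-qubit tensor `W`. -/
noncomputable def wCoeff (i j k : Fin 2) : ℂ := if (i : ℕ) + j + k = 1 then 1 else 0

theorem wCoeff_swap (i j k : Fin 2) : wCoeff j i k = wCoeff i j k := by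
  simp only [wCoeff, Nat.add_comm (j : ℕ) i]

theorem wCoeff_swap' (i j k : Fin 2) : wCoeff i k j = wCoeff i j k := by
  simp only [wCoeff, Nat.add_right_comm (i : ℕ) k j]

/-- A decomposition of `W ⊗ W` into product tensors indexed by `ι`, in coordinates. -/
structure WWDecomposition {ι : Type*} [Fintype ι] (α β γ α' β' γ' : ι → Fin 2 → ℂ) : Prop where
  sum_eq : ∀ i j k i' j' k', ∑ l, α l i * β l j * γ l k * α' l i' * β' l j' * γ' l k' =
    wCoeff i j k * wCoeff i' j' k'
  ne_zero : ∀ l, α l ≠ 0 ∧ β l ≠ 0 ∧ γ l ≠ 0 ∧ α' l ≠ 0 ∧ β' l ≠ 0 ∧ γ' l ≠ 0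

/-- The value of the product functional `a ⊗ a'` at a nonunit of `ℂ[s, t] / (s ^ 2, t ^ 2)`, given
by its coordinates with respect to `s`, `t`, `s * t`. -/
noncomputable def nonunitEval (a a' : Fin 2 → ℂ) (X : Fin 3 → ℂ) : ℂ :=
  X 0 * (a 1 * a' 0) + X 1 * (a 0 * a' 1) + X 2 * (a 1 * a' 1)

namespace WWDecomposition

variable {ι : Type*} [Fintype ι] {α β γ α' β' γ' : ι → Fin 2 → ℂ}

theorem swap₁₂ (h : WWDecomposition α β γ α' β' γ') : WWDecomposition β α γ α' β' γ' where
  sum_eq i j k i' j' k' := by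
    rw [← wCoeff_swap, ← h.sum_eq]
    exact Finset.sum_congr rfl fun l _ => by ring
  ne_zero l := by have := h.ne_zero l; tauto

theorem swap₂₃ (h : WWDecomposition α β γ α' β' γ') : WWDecomposition α γ β α' β' γ' where
  sum_eq i j k i' j' k' := by
    rw [← wCoeff_swap', ← h.sum_eq]
    exact Finset.sum_congr rfl fun l _ => by ring
  ne_zero l := by have := h.ne_zero l; tauto

theorem symm (h : WWDecomposition α β γ α' β' γ') : WWDecomposition α' β' γ' α β γ where
  sum_eq i j k i' j' k' := by
    rw [mul_comm, ← h.sum_eq]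
    exact Finset.sum_congr rfl fun l _ => by ring
  ne_zero l := by have := h.ne_zero l; tauto

theorem swap₁₂' (h : WWDecomposition α β γ α' β' γ') : WWDecomposition α β γ β' α' γ' :=
  h.symm.swap₁₂.symm

theorem swap₂₃' (h : WWDecomposition α β γ α' β' γ') : WWDecomposition α β γ α' γ' β' :=
  h.symm.swap₂₃.symm

theorem sum_nonunitEval_mul (h : WWDecomposition α β γ α' β' γ') (X : Fin 3 → ℂ)
    (j k j' k' : Fin 2) :
    ∑ l, nonunitEval (α l) (α' l) X * (β l j * β' l j') * (γ l k * γ' l k') =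
      X 0 * (wCoeff 1 j k * wCoeff 0 j' k') + X 1 * (wCoeff 0 j k * wCoeff 1 j' k') +
        X 2 * (wCoeff 1 j k * wCoeff 1 j' k') := by
  simp only [← h.sum_eq, Finset.mul_sum, ← Finset.sum_add_distrib, nonunitEval]
  exact Finset.sum_congr rfl fun l _ => by ring

theorem eq_zero_of_nonunitEval (h : WWDecomposition α β γ α' β' γ') (X : Fin 3 → ℂ)
    (hX : ∀ l, nonunitEval (α l) (α' l) X = 0) : X = 0 := by
  have h0 := h.sum_nonunitEval_mul X 0 0 1 0
  have h1 := h.sum_nonunitEval_mul X 1 0 0 0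
  have h2 := h.sum_nonunitEval_mul X 0 0 0 0
  simp only [hX, zero_mul, Finset.sum_const_zero] at h0 h1 h2
  simp [wCoeff] at h0 h1 h2
  ext i
  fin_cases i <;> simp [← h0, ← h1, ← h2]

/-! ### The substitution argument. -/

theorem exists_functional_of_linearIndepOn {κ : Type*} {n : ℕ} {v : κ → Fin n → ℂ} {s : Set κ}
    (hv : LinearIndepOn ℂ v s) (g : κ → ℂ) : ∃ X : Fin n → ℂ, ∀ l ∈ s, X ⬝ᵥ v l = g l := by
  let b := Module.Basis.span hv
  obtain ⟨f, hf⟩ := LinearMap.exists_extend (b.constr ℂ (fun l : s => g l))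
  refine ⟨fun i => f (Pi.single i 1), fun l hl => ?_⟩
  have h1 : f (v l) = g l := by
    have h2 := LinearMap.congr_fun hf (b ⟨l, hl⟩)
    rw [Module.Basis.constr_basis] at h2
    rw [← h2]
    exact congrArg (f ·.1) (Module.Basis.span_apply hv ⟨l, hl⟩).symm
  rw [← h1, dotProduct_comm]
  conv_rhs => rw [← Finset.univ_sum_single (v l), map_sum]
  refine Finset.sum_congr rfl fun i _ => ?_
  rw [← smul_eq_mul, ← map_smul, ← Pi.single_smul, smul_eq_mul, mul_one]

/-- `I` indexes a basis of the span of the functionals α ⊗ α' on the nonunits, extending one for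
`K`. Multiplication by a unit is injective, so the γ ⊗ γ' outside `I` separate A; being at most
four, they are independent. -/
theorem exists_basis (h : WWDecomposition α β γ α' β' γ') (hι : Fintype.card ι ≤ 7) (K : Set ι) :
    ∃ I : Finset ι, (∀ g : ι → ℂ, ∃ X, ∀ l ∈ I, nonunitEval (α l) (α' l) X = g l) ∧
      (∀ X, (∀ l ∈ I, l ∈ K → nonunitEval (α l) (α' l) X = 0) →
        ∀ l ∈ K, nonunitEval (α l) (α' l) X = 0) ∧
      ∀ f : ι → ℂ, (∀ l ∈ I, f l = 0) → (∀ k k', ∑ l, f l * (γ l k * γ' l k') = 0) → f = 0 := by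
  classical
  let v : ι → Fin 3 → ℂ := fun l => ![α l 1 * α' l 0, α l 0 * α' l 1, α l 1 * α' l 1]
  have hv : ∀ l X, X ⬝ᵥ v l = nonunitEval (α l) (α' l) X := fun l X => by
    simp [v, nonunitEval, dotProduct, Fin.sum_univ_succ]; ring
  obtain ⟨I₁, hI₁K, -, hI₁, hli⟩ :=
    exists_linearIndepOn_extension (linearIndepOn_empty ℂ v) (Set.empty_subset K)
  obtain ⟨I₂, -, hI₁₂, hI₂, hli₂⟩ := exists_linearIndepOn_extension hli (Set.subset_univ I₁)
  have key : ∀ (s t : Set ι), v '' t ⊆ Submodule.span ℂ (v '' s) → ∀ X,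
      (∀ l ∈ s, nonunitEval (α l) (α' l) X = 0) → ∀ l ∈ t, nonunitEval (α l) (α' l) X = 0 := by
    intro s t hst X hX l hl
    rw [← hv]
    have hle : Submodule.span ℂ (v '' s) ≤ LinearMap.ker (dotProductBilin ℂ ℂ X) := by
      rw [Submodule.span_le]
      rintro _ ⟨j, hj, rfl⟩
      simpa [hv] using hX j hj
    simpa using hle (hst ⟨l, hl, rfl⟩)
  refine ⟨I₂.toFinset, fun g => ?_, fun X hX => ?_, fun f hf0 hf => ?_⟩
  · obtain ⟨X, hX⟩ := exists_functional_of_linearIndepOn hli₂ g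
    exact ⟨X, fun l hl => by rw [← hv]; exact hX l (by simpa using hl)⟩
  · exact key I₁ K hI₁ X fun l hl => hX l (by simpa using hI₁₂ hl) (hI₁K hl)
  · have hcard : 3 ≤ I₂.toFinset.card := by
      let Φ : (Fin 3 → ℂ) →ₗ[ℂ] (I₂.toFinset → ℂ) :=
        LinearMap.pi fun l => (dotProductBilin ℂ ℂ).flip (v l)
      have hΦ : Function.Injective Φ := by
        rw [← LinearMap.ker_eq_bot, LinearMap.ker_eq_bot']
        intro X hX
        refine h.eq_zero_of_nonunitEval X fun l => key I₂ Set.univ hI₂ X (fun j hj => ?_) l trivial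
        have := congrFun hX ⟨j, by simpa using hj⟩
        simpa [Φ, hv] using this
      simpa using LinearMap.finrank_le_finrank_of_injective hΦ
    -- Every functional indexed by `I` kills the unit 1 + X.
    obtain ⟨X, hX⟩ := exists_functional_of_linearIndepOn hli₂ fun l => -(α l 0 * α' l 0)
    let Ψ : (Fin 2 × Fin 2 → ℂ) →ₗ[ℂ] ({l // l ∉ I₂.toFinset} → ℂ) :=
      LinearMap.pi fun l => ∑ k : Fin 2 × Fin 2, (γ l k.1 * γ' l k.2) • LinearMap.proj k
    have hΨ : ∀ Z l, Ψ Z l = ∑ k : Fin 2 × Fin 2, (γ l k.1 * γ' l k.2) * Z k := fun Z l => by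
      simp [Ψ]
    have hΨinj : Function.Injective Ψ := by
      rw [← LinearMap.ker_eq_bot, LinearMap.ker_eq_bot']
      intro Z hZ
      have hprod : ∀ j j', ∑ k : Fin 2 × Fin 2, Z k * (wCoeff 0 j k.1 * wCoeff 0 j' k.2 +
          (X 0 * (wCoeff 1 j k.1 * wCoeff 0 j' k.2) + X 1 * (wCoeff 0 j k.1 * wCoeff 1 j' k.2) +
            X 2 * (wCoeff 1 j k.1 * wCoeff 1 j' k.2))) = 0 := by
        intro j j'
        have hz : ∀ l, (α l 0 * α' l 0 + nonunitEval (α l) (α' l) X) *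
            ∑ k : Fin 2 × Fin 2, (γ l k.1 * γ' l k.2) * Z k = 0 := by
          intro l
          by_cases hl : l ∈ I₂
          · rw [← hv, hX l hl]; ring
          · rw [← hΨ Z ⟨l, by simpa using hl⟩, hZ]; simp
        have hs : ∑ l, β l j * β' l j' * ((α l 0 * α' l 0 + nonunitEval (α l) (α' l) X) *
            ∑ k : Fin 2 × Fin 2, (γ l k.1 * γ' l k.2) * Z k) = 0 := by simp [hz]
        rw [← hs]
        simp only [nonunitEval, ← h.sum_eq, ← Finset.sum_add_distrib, Finset.mul_sum]
        rw [Finset.sum_comm]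
        exact Finset.sum_congr rfl fun l _ => Finset.sum_congr rfl fun k _ => by ring
      have e00 := hprod 0 0
      have e01 := hprod 0 1
      have e10 := hprod 1 0
      have e11 := hprod 1 1
      simp [Fintype.sum_prod_type, wCoeff] at e00 e01 e10 e11
      simp [e11] at e01 e10
      simp [e11, e01, e10] at e00
      ext ⟨i, j⟩
      fin_cases i <;> fin_cases j <;> simp [e00, e01, e10, e11]
    have hc : Fintype.card {l // l ∉ I₂.toFinset} = Fintype.card ι - I₂.toFinset.card := by
      rw [Fintype.card_subtype_compl, Fintype.card_coe]
    have hfin : Module.finrank ℂ (Fin 2 × Fin 2 → ℂ) =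
        Module.finrank ℂ ({l // l ∉ I₂.toFinset} → ℂ) := by
      refine le_antisymm (LinearMap.finrank_le_finrank_of_injective hΨinj) ?_
      rw [Module.finrank_fintype_fun_eq_card, Module.finrank_fintype_fun_eq_card, hc, Fintype.card_prod,
        Fintype.card_fin]
      omega
    have hsurj := (LinearMap.injective_iff_surjective_of_finrank_eq_finrank hfin).1 hΨinj
    ext l₀
    by_cases hl₀ : l₀ ∈ I₂.toFinset
    · exact hf0 l₀ hl₀
    obtain ⟨Z, hZ⟩ := hsurj (Pi.single ⟨l₀, hl₀⟩ 1)
    have hs : ∑ k : Fin 2 × Fin 2, Z k * ∑ l, f l * (γ l k.1 * γ' l k.2) = 0 := by simp [hf]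
    have hs' : ∑ l, f l * ∑ k : Fin 2 × Fin 2, (γ l k.1 * γ' l k.2) * Z k = 0 := by
      rw [← hs]
      simp only [Finset.mul_sum]
      rw [Finset.sum_comm]
      exact Finset.sum_congr rfl fun l _ => Finset.sum_congr rfl fun k _ => by ring
    rw [Finset.sum_eq_single l₀ (fun l _ hl => ?_) (by simp)] at hs'
    · rw [← hΨ Z ⟨l₀, hl₀⟩, hZ, Pi.single_eq_same, mul_one] at hs'
      exact hs'
    · by_cases hlI : l ∈ I₂.toFinset
      · rw [hf0 l hlI, zero_mul]
      · rw [← hΨ Z ⟨l, hlI⟩, hZ, Pi.single_eq_of_ne (by simpa using hl), mul_zero]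

end WWDecomposition

/-! ### Splitting along a support. -/

namespace WWDecomposition

variable {ι : Type*} [Fintype ι] {α β γ α' β' γ' : ι → Fin 2 → ℂ}

/-- Interpolate on a basis adapted to the complement of the support. The error times β ⊗ β' at st is
a relation among the γ ⊗ γ', since a nonunit times st is 0. -/
theorem exists_split (h : WWDecomposition α β γ α' β' γ') (hι : Fintype.card ι ≤ 7)
    (X : Fin 3 → ℂ) : ∃ Y, ∀ l, nonunitEval (α l) (α' l) Y =
      if β l 1 * β' l 1 = 0 then 0 else nonunitEval (α l) (α' l) X := by
  obtain ⟨I, hI, hK, hC⟩ := h.exists_basis hι {l | β l 1 * β' l 1 = 0}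
  obtain ⟨Y, hY⟩ := hI fun l => if β l 1 * β' l 1 = 0 then 0 else nonunitEval (α l) (α' l) X
  refine ⟨Y, fun l => ?_⟩
  split_ifs with hl
  · exact hK Y (fun j hj hjK => (hY j hj).trans (if_pos hjK)) l hl
  · have hf := hC (fun l => β l 1 * β' l 1 *
      (nonunitEval (α l) (α' l) Y - nonunitEval (α l) (α' l) X)) (fun j hj => ?_) fun k k' => ?_
    · simpa [hl, sub_eq_zero] using congrFun hf l
    · rw [hY j hj]
      split_ifs with hj0
      · rw [hj0, zero_mul]
      · rw [sub_self, mul_zero]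
    · have h1 := h.sum_nonunitEval_mul Y 1 k 1 k'
      have h2 := h.sum_nonunitEval_mul X 1 k 1 k'
      have h3 : ∀ m, wCoeff 1 1 m = 0 := fun m => by simp [wCoeff]; omega
      simp only [h3, zero_mul, mul_zero, add_zero] at h1 h2
      rw [← sub_self (0 : ℂ)]
      nth_rw 1 [← h1]
      rw [← h2, ← Finset.sum_sub_distrib]
      exact Finset.sum_congr rfl fun l _ => by ring

/-- The form at (X, 1, Z) is the coefficient of st in XZ, the pairing used for adjointness. -/
theorem sum_nonunitEval_mul_nonunitEval (h : WWDecomposition α β γ α' β' γ') (X Z : Fin 3 → ℂ) :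
    ∑ l, nonunitEval (α l) (α' l) X * (β l 0 * β' l 0) * nonunitEval (γ l) (γ' l) Z =
      X 0 * Z 1 + X 1 * Z 0 := by
  have h0 := h.sum_nonunitEval_mul X 0 1 0 0
  have h1 := h.sum_nonunitEval_mul X 0 0 0 1
  have h2 := h.sum_nonunitEval_mul X 0 1 0 1
  simp only [wCoeff] at h0 h1 h2
  norm_num at h0 h1 h2
  have h3 : ∑ l, nonunitEval (α l) (α' l) X * (β l 0 * β' l 0) * nonunitEval (γ l) (γ' l) Z =
      Z 0 * ∑ l, nonunitEval (α l) (α' l) X * (β l 0 * β' l 0) * (γ l 1 * γ' l 0) +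
      Z 1 * ∑ l, nonunitEval (α l) (α' l) X * (β l 0 * β' l 0) * (γ l 0 * γ' l 1) +
      Z 2 * ∑ l, nonunitEval (α l) (α' l) X * (β l 0 * β' l 0) * (γ l 1 * γ' l 1) := by
    simp only [Finset.mul_sum, ← Finset.sum_add_distrib]
    exact Finset.sum_congr rfl fun l _ => by rw [nonunitEval.eq_def (γ l)]; ring
  rw [h3, h0, h1, h2]
  ring

/-- The support of `β ⊗ β'` at `s * t` splits the functionals `α ⊗ α'` and `γ ⊗ γ'` on the nonunits
in an adjoint way. -/
theorem exists_adjoint_split (h : WWDecomposition α β γ α' β' γ') (hι : Fintype.card ι ≤ 7) :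
    ∃ (χ : ι → ℂ) (p q r p' q' r' e ρ ρ' : ℂ),
      (∀ l, β l 1 ≠ 0 → β' l 1 ≠ 0 → χ l = 1) ∧
      (∀ l, β l 1 = 0 ∨ β' l 1 = 0 → χ l = 0) ∧
      (∀ l, p * (α l 1 * α' l 0) + q * (α l 0 * α' l 1) + r * (α l 1 * α' l 1) =
        χ l * (α l 1 * α' l 0)) ∧
      (∀ l, p' * (α l 1 * α' l 0) + q' * (α l 0 * α' l 1) + r' * (α l 1 * α' l 1) =
        χ l * (α l 0 * α' l 1)) ∧
      (∀ l, e * (α l 1 * α' l 1) = χ l * (α l 1 * α' l 1)) ∧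
      (∀ l, q' * (γ l 1 * γ' l 0) + q * (γ l 0 * γ' l 1) + ρ * (γ l 1 * γ' l 1) =
        χ l * (γ l 1 * γ' l 0)) ∧
      (∀ l, p' * (γ l 1 * γ' l 0) + p * (γ l 0 * γ' l 1) + ρ' * (γ l 1 * γ' l 1) =
        χ l * (γ l 0 * γ' l 1)) ∧
      ((∀ l, χ l * (γ l 1 * γ' l 0) = 0) → q = 0 ∧ q' = 0) ∧
      ((∀ l, χ l * (γ l 0 * γ' l 1) = 0) → p = 0 ∧ p' = 0) := by
  have hγ : WWDecomposition γ β α γ' β' α' := h.swap₁₂.swap₂₃.swap₁₂.swap₁₂'.swap₂₃'.swap₁₂'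
  choose P hP using h.exists_split hι
  choose Q hQ using hγ.exists_split hι
  -- Both sides equal the sum of α(X) β(1) γ(Z) over the support of β ⊗ β' at st.
  have hadj : ∀ X Z, P X 0 * Z 1 + P X 1 * Z 0 = X 0 * Q Z 1 + X 1 * Q Z 0 := by
    intro X Z
    rw [← h.sum_nonunitEval_mul_nonunitEval, ← h.sum_nonunitEval_mul_nonunitEval]
    refine Finset.sum_congr rfl fun l _ => ?_
    rw [hP, hQ]
    split_ifs <;> simp
  have hsingle : ∀ (a a' : Fin 2 → ℂ), nonunitEval a a' (Pi.single 0 1) = a 1 * a' 0 ∧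
      nonunitEval a a' (Pi.single 1 1) = a 0 * a' 1 ∧
      nonunitEval a a' (Pi.single 2 1) = a 1 * a' 1 := fun a a' => by simp [nonunitEval]
  have a00 := hadj (Pi.single 0 1) (Pi.single 0 1)
  have a01 := hadj (Pi.single 0 1) (Pi.single 1 1)
  have a10 := hadj (Pi.single 1 1) (Pi.single 0 1)
  have a11 := hadj (Pi.single 1 1) (Pi.single 1 1)
  have a20 := hadj (Pi.single 2 1) (Pi.single 0 1)
  have a21 := hadj (Pi.single 2 1) (Pi.single 1 1)
  simp at a00 a01 a10 a11 a20 a21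
  have hχ : ∀ l (x : ℂ), (if β l 1 * β' l 1 = 0 then 0 else x) =
      (if β l 1 * β' l 1 = 0 then 0 else 1) * x := fun l x => by split_ifs <;> simp
  refine ⟨fun l => if β l 1 * β' l 1 = 0 then 0 else 1,
    P (Pi.single 0 1) 0, P (Pi.single 0 1) 1, P (Pi.single 0 1) 2,
    P (Pi.single 1 1) 0, P (Pi.single 1 1) 1, P (Pi.single 1 1) 2,
    P (Pi.single 2 1) 2, Q (Pi.single 0 1) 2, Q (Pi.single 1 1) 2,
    fun l h1 h2 => if_neg (mul_ne_zero h1 h2), fun l hl => if_pos (mul_eq_zero.2 hl), ?_⟩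
  refine ⟨fun l => ?_, fun l => ?_, fun l => ?_, fun l => ?_, fun l => ?_, fun hz => ?_,
    fun hz => ?_⟩
  · have := hP (Pi.single 0 1) l
    rwa [(hsingle _ _).1, hχ] at this
  · have := hP (Pi.single 1 1) l
    rwa [(hsingle _ _).2.1, hχ] at this
  · have := hP (Pi.single 2 1) l
    rw [(hsingle _ _).2.2, hχ, nonunitEval, a20, a21] at this
    simpa using this
  · have := hQ (Pi.single 0 1) l
    rw [(hsingle _ _).1, hχ, nonunitEval, ← a10, ← a00] at this
    exact this
  · have := hQ (Pi.single 1 1) l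
    rw [(hsingle _ _).2.1, hχ, nonunitEval, ← a11, ← a01] at this
    exact this
  · have h0 := hγ.eq_zero_of_nonunitEval (Q (Pi.single 0 1)) fun l => by
      rw [hQ, (hsingle _ _).1, hχ]; exact hz l
    rw [a00, a10, h0]
    simp
  · have h0 := hγ.eq_zero_of_nonunitEval (Q (Pi.single 1 1)) fun l => by
      rw [hQ, (hsingle _ _).2.1, hχ]; exact hz l
    rw [a01, a11, h0]
    simp

/-! ### Constraints on the supports. -/

/-- The form is 1 at (1, st, 1) and 0 at (s, st, 1); proportionality would make the first `c` times
the second. -/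
theorem not_parallel (h : WWDecomposition α β γ α' β' γ') (c : ℂ)
    (hc : ∀ l, β l 1 ≠ 0 → β' l 1 ≠ 0 → α l 0 = c * α l 1) : False := by
  have h1 := h.sum_eq 0 1 0 0 1 0
  have h2 := h.sum_eq 1 1 0 0 1 0
  have h3 : ∑ l, α l 0 * β l 1 * γ l 0 * α' l 0 * β' l 1 * γ' l 0 =
      c * ∑ l, α l 1 * β l 1 * γ l 0 * α' l 0 * β' l 1 * γ' l 0 := by
    rw [Finset.mul_sum]
    refine Finset.sum_congr rfl fun l _ => ?_
    by_cases hb : β l 1 = 0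
    · simp [hb]
    by_cases hb' : β' l 1 = 0
    · simp [hb']
    rw [hc l hb hb']
    ring
  rw [h3, h2] at h1
  simp [wCoeff] at h1

theorem exists_ne_zero (h : WWDecomposition α β γ α' β' γ') : ∃ l, β l 1 ≠ 0 ∧ β' l 1 ≠ 0 := by
  by_contra! hne
  exact h.not_parallel 0 fun l h1 h2 => absurd (hne l h1) h2

/-- The cut sends st to `e` times st; a common summand forces `e = 1`. -/
theorem support_subset (h : WWDecomposition α β γ α' β' γ') (hι : Fintype.card ι ≤ 7) {l j : ι}
    (hl : α l 1 ≠ 0 ∧ α' l 1 ≠ 0) (hl' : β l 1 ≠ 0 ∧ β' l 1 ≠ 0)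
    (hj : α j 1 ≠ 0 ∧ α' j 1 ≠ 0) : β j 1 ≠ 0 ∧ β' j 1 ≠ 0 := by
  obtain ⟨χ, p, q, r, p', q', r', e, ρ, ρ', h1, h0, -, -, he, -⟩ := h.exists_adjoint_split hι
  have e1 := mul_right_cancel₀ (mul_ne_zero hl.1 hl.2) (he l)
  have e2 := mul_right_cancel₀ (mul_ne_zero hj.1 hj.2) (he j)
  rw [h1 l hl'.1 hl'.2] at e1
  by_contra hne
  rw [e1, h0 j (by tauto)] at e2
  exact one_ne_zero e2

theorem support_iff (h : WWDecomposition α β γ α' β' γ') (hι : Fintype.card ι ≤ 7) {l : ι}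
    (hl : α l 1 ≠ 0 ∧ α' l 1 ≠ 0) (hl' : β l 1 ≠ 0 ∧ β' l 1 ≠ 0) (j : ι) :
    α j 1 ≠ 0 ∧ α' j 1 ≠ 0 ↔ β j 1 ≠ 0 ∧ β' j 1 ≠ 0 :=
  ⟨h.support_subset hι hl hl', h.swap₁₂.swap₁₂'.support_subset hι hl' hl⟩

theorem apply_zero_ne_zero {a : Fin 2 → ℂ} (ha : a ≠ 0) (h1 : a 1 = 0) : a 0 ≠ 0 := by
  contrapose! ha
  ext i
  fin_cases i <;> assumption

/-- Among s, t, st such functionals see only s, so `χ` takes the same value `p` at both summands. -/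
theorem same_side (h : WWDecomposition α β γ α' β' γ') (hι : Fintype.card ι ≤ 7) {l j : ι}
    (hl : α l 1 ≠ 0) (hl' : α' l 1 = 0) (hj : α j 1 ≠ 0) (hj' : α' j 1 = 0)
    (hlT : β l 1 ≠ 0 ∧ β' l 1 ≠ 0) : β j 1 ≠ 0 ∧ β' j 1 ≠ 0 := by
  obtain ⟨χ, p, q, r, p', q', r', e, ρ, ρ', h1, h0, hp, -⟩ := h.exists_adjoint_split hι
  have e1 := hp l
  have e2 := hp j
  simp only [hl', hj', mul_zero, add_zero] at e1 e2
  have e3 := mul_right_cancel₀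
    (mul_ne_zero hl (apply_zero_ne_zero (h.ne_zero l).2.2.2.1 hl')) e1
  have e4 := mul_right_cancel₀
    (mul_ne_zero hj (apply_zero_ne_zero (h.ne_zero j).2.2.2.1 hj')) e2
  rw [h1 l hlT.1 hlT.2] at e3
  by_contra hne
  rw [e3, h0 j (by tauto)] at e4
  exact one_ne_zero e4

/-- By adjointness the entry `p` for s on the α side is also the entry for t on the γ side. -/
theorem opposite_side (h : WWDecomposition α β γ α' β' γ') (hι : Fintype.card ι ≤ 7) {l j : ι}
    (hl : γ' l 1 ≠ 0) (hl' : γ l 1 = 0) (hj : α j 1 ≠ 0) (hj' : α' j 1 = 0)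
    (hlT : β l 1 ≠ 0 ∧ β' l 1 ≠ 0) : β j 1 ≠ 0 ∧ β' j 1 ≠ 0 := by
  obtain ⟨χ, p, q, r, p', q', r', e, ρ, ρ', h1, h0, hp, -, -, -, hp', -⟩ :=
    h.exists_adjoint_split hι
  have e1 := hp' l
  have e2 := hp j
  simp only [hl', hj', mul_zero, zero_mul, add_zero, zero_add] at e1 e2
  have e3 := mul_right_cancel₀
    (mul_ne_zero (apply_zero_ne_zero (h.ne_zero l).2.2.1 hl') hl) e1
  have e4 := mul_right_cancel₀
    (mul_ne_zero hj (apply_zero_ne_zero (h.ne_zero j).2.2.2.1 hj')) e2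
  rw [h1 l hlT.1 hlT.2] at e3
  by_contra hne
  rw [e3, h0 j (by tauto)] at e4
  exact one_ne_zero e4

/-- Otherwise the cut of t on the γ side is 0, so `p = 0`, whereas `l` gives `p = 1`. -/
theorem exists_support (h : WWDecomposition α β γ α' β' γ') (hι : Fintype.card ι ≤ 7) {l : ι}
    (hl : α l 1 ≠ 0) (hl' : α' l 1 = 0) (hlT : β l 1 ≠ 0 ∧ β' l 1 ≠ 0) :
    ∃ j, (β j 1 ≠ 0 ∧ β' j 1 ≠ 0) ∧ γ' j 1 ≠ 0 := by
  obtain ⟨χ, p, q, r, p', q', r', e, ρ, ρ', h1, h0, hp, -, -, -, -, -, hz⟩ :=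
    h.exists_adjoint_split hι
  have e1 := hp l
  simp only [hl', mul_zero, add_zero] at e1
  have e3 := mul_right_cancel₀
    (mul_ne_zero hl (apply_zero_ne_zero (h.ne_zero l).2.2.2.1 hl')) e1
  rw [h1 l hlT.1 hlT.2] at e3
  by_contra! hne
  refine one_ne_zero (e3.symm.trans (hz fun j => ?_).1)
  by_cases hj : β j 1 ≠ 0 ∧ β' j 1 ≠ 0
  · rw [hne j hj, mul_zero, mul_zero]
  · rw [h0 j (by tauto), zero_mul]

/-- Otherwise `l` gives `p = p' = 0`, so t is cut to a multiple of st on the γ side, which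
contradicts `not_parallel` for γ. -/
theorem subset_support (h : WWDecomposition α β γ α' β' γ') (hι : Fintype.card ι ≤ 7)
    (hT : ∀ l, β l 1 ≠ 0 ∧ β' l 1 ≠ 0 → γ' l 1 ≠ 0) {l : ι} (hl : α l 1 ≠ 0) (hl' : α' l 1 = 0) :
    β l 1 ≠ 0 ∧ β' l 1 ≠ 0 := by
  obtain ⟨χ, p, q, r, p', q', r', e, ρ, ρ', h1, h0, hp, hq, -, -, hp', -⟩ :=
    h.exists_adjoint_split hι
  by_contra hne
  have hnz := mul_ne_zero hl (apply_zero_ne_zero (h.ne_zero l).2.2.2.1 hl')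
  have e1 := hp l
  have e2 := hq l
  simp only [hl', mul_zero, add_zero, h0 l (by tauto), zero_mul, mul_eq_zero] at e1 e2
  have e3 : p = 0 := by simpa [mul_ne_zero_iff.1 hnz] using e1
  have e4 : p' = 0 := by simpa [mul_ne_zero_iff.1 hnz] using e2
  refine h.swap₁₂.swap₂₃.swap₁₂.swap₁₂'.swap₂₃'.swap₁₂'.not_parallel ρ' fun j hj hj' => ?_
  have e5 := hp' j
  rw [e3, e4, h1 j hj hj'] at e5
  apply mul_right_cancel₀ (hT j ⟨hj, hj'⟩)
  linear_combination -e5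

/-- On the γ side s and t are cut to 0, so by adjointness t is cut to a multiple of st on the α
side, against `not_parallel`. -/
theorem not_disjoint (h : WWDecomposition α β γ α' β' γ') (hι : Fintype.card ι ≤ 7)
    (hT : ∀ l, β l 1 ≠ 0 ∧ β' l 1 ≠ 0 → γ l 1 = 0 ∧ γ' l 1 = 0 ∧ α' l 1 ≠ 0) : False := by
  obtain ⟨χ, p, q, r, p', q', r', e, ρ, ρ', h1, h0, -, hq, -, -, -, hz, hz'⟩ :=
    h.exists_adjoint_split hι
  have hχ : ∀ j, χ j = 0 ∨ γ j 1 = 0 ∧ γ' j 1 = 0 := fun j => by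
    by_cases hj : β j 1 ≠ 0 ∧ β' j 1 ≠ 0
    · have := hT j hj; tauto
    · exact .inl (h0 j (by tauto))
  have e1 := (hz fun j => by rcases hχ j with h | h <;> simp [h]).2
  have e2 := (hz' fun j => by rcases hχ j with h | h <;> simp [h]).2
  refine h.not_parallel r' fun j hj hj' => ?_
  have e5 := hq j
  rw [e1, e2, h1 j hj hj'] at e5
  apply mul_right_cancel₀ (hT j ⟨hj, hj'⟩).2.2
  linear_combination -e5

end WWDecomposition

/-! ### Short expressions for a single W. -/

/-- Padding terms have `ε = 0` but still repeat an element of `s`, so properties of `s` hold at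
every index. -/
theorem exists_fin_sum {ι : Type*} {n : ℕ} (s : Finset ι) (hs : s.Nonempty) (hn : s.card ≤ n) :
    ∃ (a : Fin n → ι) (ε : Fin n → ℂ), (∀ i, a i ∈ s) ∧
      ∀ g : ι → ℂ, ∑ l ∈ s, g l = ∑ i, ε i * g (a i) := by
  obtain ⟨x, hx⟩ := hs
  obtain ⟨φ⟩ : Nonempty (s ↪ Fin n) := Function.Embedding.nonempty_of_card_le (by simpa using hn)
  refine ⟨Function.extend φ Subtype.val fun _ => x, Function.extend φ 1 0, fun i => ?_, fun g => ?_⟩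
  · by_cases hi : ∃ y, φ y = i
    · obtain ⟨y, rfl⟩ := hi
      rw [φ.injective.extend_apply]
      exact y.2
    · rwa [Function.extend_apply' _ _ _ hi]
  · rw [← Finset.sum_coe_sort]
    refine Fintype.sum_of_injective φ φ.injective _ _ (fun i hi => ?_) fun y => ?_
    · rw [Function.extend_apply' _ _ _ hi]; simp
    · rw [φ.injective.extend_apply, φ.injective.extend_apply]; simp

/-- The tensor `W` is not the sum of two product tensors. -/
theorem sum_two_ne_wCoeff (a b c : Fin 2 → Fin 2 → ℂ) (e : Fin 2 → ℂ)
    (h : ∀ i j k, ∑ m, e m * (a m i * b m j * c m k) = wCoeff i j k) : False := by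
  simp only [Fin.sum_univ_two] at h
  have h000 := h 0 0 0
  have h001 := h 0 0 1
  have h010 := h 0 1 0
  have h011 := h 0 1 1
  have h100 := h 1 0 0
  have h101 := h 1 0 1
  have h110 := h 1 1 0
  have h111 := h 1 1 1
  simp [wCoeff] at h000 h001 h010 h011 h100 h101 h110 h111
  -- Contracted with x in the first factor, W has determinant -x₀², and two products have κ
  -- (a₀·x)(a₁·x); `k0`, `k1`, `k2` compare coefficients.
  obtain ⟨κ, hκ⟩ : ∃ κ, κ = e 0 * e 1 * (b 0 0 * b 1 1 - b 0 1 * b 1 0) *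
    (c 0 0 * c 1 1 - c 0 1 * c 1 0) := ⟨_, rfl⟩
  have k0 : κ * (a 0 0 * a 1 0) = -1 := by
    rw [hκ]
    linear_combination (e 0 * (a 0 0 * b 0 1 * c 0 1) + e 1 * (a 1 0 * b 1 1 * c 1 1)) * h000 -
      (e 0 * (a 0 0 * b 0 1 * c 0 0) + e 1 * (a 1 0 * b 1 1 * c 1 0)) * h001 - h010
  have k1 : κ * (a 0 1 * a 1 1) = 0 := by
    rw [hκ]
    linear_combination (e 0 * (a 0 1 * b 0 1 * c 0 1) + e 1 * (a 1 1 * b 1 1 * c 1 1)) * h100 -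
      (e 0 * (a 0 1 * b 0 1 * c 0 0) + e 1 * (a 1 1 * b 1 1 * c 1 0)) * h101 + h111
  have k2 : κ * (a 0 0 * a 1 1 + a 0 1 * a 1 0) = 0 := by
    rw [hκ]
    linear_combination (e 0 * (a 0 1 * b 0 1 * c 0 1) + e 1 * (a 1 1 * b 1 1 * c 1 1)) * h000 +
      (e 0 * (a 0 0 * b 0 1 * c 0 1) + e 1 * (a 1 0 * b 1 1 * c 1 1)) * h100 -
      (e 0 * (a 0 0 * b 0 1 * c 0 0) + e 1 * (a 1 0 * b 1 1 * c 1 0)) * h101 -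
      (e 0 * (a 0 1 * b 0 1 * c 0 0) + e 1 * (a 1 1 * b 1 1 * c 1 0)) * h001 - h110 + h011
  have hκ0 : κ ≠ 0 := by rintro rfl; simp at k0
  have ha0 : a 0 0 ≠ 0 := by rintro h; simp [h] at k0
  have ha1 : a 1 0 ≠ 0 := by rintro h; simp [h] at k0
  simp only [mul_eq_zero, hκ0, false_or] at k1 k2
  rcases k1 with k1 | k1 <;> simp [k1, ha0, ha1] at k2 <;> simp [k1, k2] at h100

/-- If `W` is a combination of four product tensors, with coefficients `c i * t i`, then there
is no relation with coefficients `c i` between these. -/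
theorem not_relation_of_sum_four (a b g : Fin 4 → Fin 2 → ℂ) (c t : Fin 4 → ℂ) (ha : a 0 1 ≠ 0)
    (h0 : ∀ i j k, ∑ m, c m * (a m i * b m j * g m k) = 0)
    (h1 : ∀ i j k, ∑ m, c m * t m * (a m i * b m j * g m k) = wCoeff i j k) : False := by
  -- Contracting the first factor with (a 0 1, -a 0 0) removes the summand 0.
  obtain ⟨d, hd⟩ : ∃ d : Fin 4 → ℂ, ∀ m, d m = c m * (a m 0 * a 0 1 - a m 1 * a 0 0) :=
    ⟨_, fun _ => rfl⟩
  have hd0 : d 0 = 0 := by rw [hd]; ring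
  have r0 : ∀ j k, d 1 * (b 1 j * g 1 k) + d 2 * (b 2 j * g 2 k) + d 3 * (b 3 j * g 3 k) = 0 := by
    intro j k
    have e0 := h0 0 j k
    have e1 := h0 1 j k
    rw [Fin.sum_univ_four] at e0 e1
    rw [hd, hd, hd]
    linear_combination a 0 1 * e0 - a 0 0 * e1
  have r1 : ∀ j k, d 2 * (t 2 - t 1) * (b 2 j * g 2 k) + d 3 * (t 3 - t 1) * (b 3 j * g 3 k) =
      a 0 1 * wCoeff 0 j k - a 0 0 * wCoeff 1 j k := by
    intro j k
    have e0 := h1 0 j k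
    have e1 := h1 1 j k
    have e2 := r0 j k
    rw [Fin.sum_univ_four] at e0 e1
    rw [hd, hd, hd] at e2
    rw [hd, hd]
    linear_combination a 0 1 * e0 - a 0 0 * e1 - t 1 * e2
  obtain ⟨κ, hκ⟩ : ∃ κ, κ = d 2 * d 3 * (b 2 0 * b 3 1 - b 2 1 * b 3 0) *
    (g 2 0 * g 3 1 - g 2 1 * g 3 0) := ⟨_, rfl⟩
  -- `κ` is the determinant of a matrix that equals minus the rank-one term 1 in `r0`.
  have k0 : κ = 0 := by
    have e00 := r0 0 0
    have e01 := r0 0 1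
    have e10 := r0 1 0
    have e11 := r0 1 1
    rw [hκ]
    linear_combination (d 2 * (b 2 1 * g 2 1) + d 3 * (b 3 1 * g 3 1)) * e00 -
      d 1 * (b 1 0 * g 1 0) * e11 - (d 2 * (b 2 1 * g 2 0) + d 3 * (b 3 1 * g 3 0)) * e01 +
      d 1 * (b 1 0 * g 1 1) * e10
  -- These are the determinants of the two sides of `r1`.
  have k1 : (t 2 - t 1) * (t 3 - t 1) * κ = -(a 0 1) ^ 2 := by
    have e00 := r1 0 0
    have e01 := r1 0 1
    have e10 := r1 1 0
    have e11 := r1 1 1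
    simp [wCoeff] at e00 e01 e10 e11
    rw [hκ]
    linear_combination
      (d 2 * (t 2 - t 1) * (b 2 1 * g 2 1) + d 3 * (t 3 - t 1) * (b 3 1 * g 3 1)) * e00 -
      a 0 0 * e11 -
      (d 2 * (t 2 - t 1) * (b 2 1 * g 2 0) + d 3 * (t 3 - t 1) * (b 3 1 * g 3 0)) * e01 -
      a 0 1 * e10
  rw [k0, mul_zero, eq_comm, neg_eq_zero] at k1
  exact ha (pow_eq_zero_iff two_ne_zero |>.1 k1)

/-! ### Disjointness of the supports. -/

namespace WWDecomposition

variable {ι : Type*} [Fintype ι] {α β γ α' β' γ' : ι → Fin 2 → ℂ}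

/-- Solve for X on a basis `I`. The difference of the two sides is a relation among the γ ⊗ γ',
because e₁, e₁ in two slots annihilate W. -/
theorem exists_eq_nonunitEval (h : WWDecomposition α β γ α' β' γ') (hι : Fintype.card ι ≤ 7)
    (hβ : ∀ l, α l 1 ≠ 0 ∨ α' l 1 ≠ 0 → β l 1 ≠ 0 ∧ β' l 1 ≠ 0) :
    ∃ X, ∀ l, α l 0 * β l 0 * (α' l 1 * β' l 1) =
      β l 1 * β' l 1 * nonunitEval (α l) (α' l) X := by
  obtain ⟨I, hI, -, hC⟩ := h.exists_basis hι ∅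
  have hb : ∀ l ∈ I, β l 1 * β' l 1 ≠ 0 := by
    intro l hl
    -- Basis functionals are nonzero on the nonunits, so `hβ` applies.
    obtain ⟨Y, hY⟩ := hI 1
    have := hY l hl
    intro hne
    have h1 : ¬ (α l 1 ≠ 0 ∨ α' l 1 ≠ 0) := fun h' =>
      mul_ne_zero (hβ l h').1 (hβ l h').2 hne
    push Not at h1
    simp [nonunitEval, h1] at this
  obtain ⟨X, hX⟩ := hI fun l => α l 0 * β l 0 * (α' l 1 * β' l 1) / (β l 1 * β' l 1)
  refine ⟨X, fun l => ?_⟩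
  rw [← sub_eq_zero]
  refine congrFun (hC (fun l => α l 0 * β l 0 * (α' l 1 * β' l 1) -
    β l 1 * β' l 1 * nonunitEval (α l) (α' l) X) (fun j hj => ?_) fun k k' => ?_) l
  · rw [hX j hj, mul_div_cancel₀ _ (hb j hj), sub_self]
  · have h1 := h.sum_eq 0 0 k 1 1 k'
    have h2 := h.sum_nonunitEval_mul X 1 k 1 k'
    have h3 : ∀ m, wCoeff 1 1 m = 0 := fun m => by simp [wCoeff]; omega
    simp only [h3, zero_mul, mul_zero, add_zero] at h1 h2
    rw [← sub_self (0 : ℂ)]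
    nth_rw 1 [← h1]
    rw [← h2, ← Finset.sum_sub_distrib]
    exact Finset.sum_congr rfl fun l _ => by ring

/-- Multiplying two instances of `exists_eq_nonunitEval` turns a coordinate equal to 1 into the form
at two nonunits and st, which is 0. -/
theorem not_all_supports_eq (h : WWDecomposition α β γ α' β' γ') (hι : Fintype.card ι ≤ 7)
    (hN : ∀ l, (α l 1 ≠ 0 ∧ β l 1 ≠ 0 ∧ γ l 1 ≠ 0 ∧ α' l 1 ≠ 0 ∧ β' l 1 ≠ 0 ∧ γ' l 1 ≠ 0) ∨
      (α l 1 = 0 ∧ β l 1 = 0 ∧ γ l 1 = 0 ∧ α' l 1 = 0 ∧ β' l 1 = 0 ∧ γ' l 1 = 0)) : False := by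
  obtain ⟨X, hX⟩ := h.exists_eq_nonunitEval hι fun l => by have := hN l; tauto
  obtain ⟨Y, hY⟩ := h.symm.swap₁₂.swap₁₂'.exists_eq_nonunitEval hι fun l => by have := hN l; tauto
  have h1 := h.sum_eq 0 0 1 0 0 1
  have h2 : ∀ l, α l 0 * β l 0 * γ l 1 * α' l 0 * β' l 0 * γ' l 1 =
      nonunitEval (α l) (α' l) X * nonunitEval (β' l) (β l) Y * (γ l 1 * γ' l 1) := by
    intro l
    rcases hN l with hl | hl
    · have e1 := hX l
      have e2 := hY l
      have hnz : α l 1 * β l 1 * α' l 1 * β' l 1 ≠ 0 := by simp [hl]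
      apply mul_left_cancel₀ hnz
      linear_combination (γ l 1 * γ' l 1) * (β' l 0 * α' l 0 * (β l 1 * α l 1) * e1 +
        β l 1 * β' l 1 * nonunitEval (α l) (α' l) X * e2)
    · simp [hl]
  have h3 : ∀ m, wCoeff 1 m 1 = 0 := fun m => by simp [wCoeff]
  have h4 : ∀ j j', ∑ l, nonunitEval (α l) (α' l) X * (β l j * β' l j') * (γ l 1 * γ' l 1) = 0 :=
    fun j j' => by rw [h.sum_nonunitEval_mul]; simp [h3]
  have h5 : ∑ l, nonunitEval (α l) (α' l) X * nonunitEval (β' l) (β l) Y * (γ l 1 * γ' l 1) =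
      Y 0 * ∑ l, nonunitEval (α l) (α' l) X * (β l 0 * β' l 1) * (γ l 1 * γ' l 1) +
      Y 1 * ∑ l, nonunitEval (α l) (α' l) X * (β l 1 * β' l 0) * (γ l 1 * γ' l 1) +
      Y 2 * ∑ l, nonunitEval (α l) (α' l) X * (β l 1 * β' l 1) * (γ l 1 * γ' l 1) := by
    simp only [Finset.mul_sum, ← Finset.sum_add_distrib]
    exact Finset.sum_congr rfl fun l _ => by rw [nonunitEval.eq_def (β' l)]; ring
  rw [Finset.sum_congr rfl fun l _ => h2 l, h5, h4, h4, h4] at h1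
  simp [wCoeff] at h1

/-- Fixing coordinates 0, 0, 1 in the first copy leaves W as a sum over these summands. -/
theorem three_le_card (h : WWDecomposition α β γ α' β' γ') :
    3 ≤ (Finset.univ.filter fun l => γ l 1 ≠ 0).card := by
  have hsum : ∀ i j k, ∑ l ∈ Finset.univ.filter (fun l => γ l 1 ≠ 0),
      α l 0 * β l 0 * γ l 1 * α' l i * β' l j * γ' l k = wCoeff i j k := by
    intro i j k
    rw [Finset.sum_filter_of_ne fun l _ hl => by contrapose! hl; simp [hl], h.sum_eq]
    simp [wCoeff]
  by_contra! hlt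
  obtain ⟨a, ε, -, hε⟩ := exists_fin_sum (n := 2) (Finset.univ.filter fun l => γ l 1 ≠ 0) (by
    by_contra hne
    rw [Finset.not_nonempty_iff_eq_empty] at hne
    have := hsum 0 0 1
    rw [hne] at this
    simp [wCoeff] at this) (by omega)
  refine sum_two_ne_wCoeff (fun m => α' (a m)) (fun m => β' (a m)) (fun m => γ' (a m))
    (fun m => ε m * (α (a m) 0 * β (a m) 0 * γ (a m) 1)) fun i j k => ?_
  rw [← hsum, hε]
  exact Finset.sum_congr rfl fun m _ => by ring

/-- By `three_le_card` at most four summands have `α l 1 ≠ 0`. With coordinates 1 and 0 fixed in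
slots one and three, coordinate 1 in slot two gives a relation and coordinate 0 gives W, with
coefficient ratios β₀/β₁. -/
theorem not_disjoint_third (h : WWDecomposition α β γ α' β' γ') (hι : Fintype.card ι ≤ 7)
    (hβ : ∀ l, α l 1 ≠ 0 → β l 1 ≠ 0) (hC : ∀ l, α l 1 ≠ 0 → γ l 1 = 0 ∧ α' l 1 ≠ 0) : False := by
  classical
  let T := Finset.univ.filter fun l => α l 1 ≠ 0
  have hT : ∀ j i' j' k', ∑ l ∈ T, α l 1 * β l j * γ l 0 * α' l i' * β' l j' * γ' l k' =
      wCoeff 1 j 0 * wCoeff i' j' k' := by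
    intro j i' j' k'
    rw [Finset.sum_filter_of_ne fun l _ hl => by contrapose! hl; simp [hl], h.sum_eq]
  have hcard : T.card ≤ 4 := by
    have hd : Disjoint T (Finset.univ.filter fun l => γ l 1 ≠ 0) := by
      rw [Finset.disjoint_filter]
      exact fun l _ hl => not_not.2 (hC l hl).1
    have h1 := h.three_le_card
    have h2 := Finset.card_le_univ (T ∪ Finset.univ.filter fun l => γ l 1 ≠ 0)
    rw [Finset.card_union_of_disjoint hd] at h2
    omega
  obtain ⟨a, ε, haT, hε⟩ := exists_fin_sum T (by
    by_contra hne
    rw [Finset.not_nonempty_iff_eq_empty] at hne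
    have := hT 0 0 0 1
    rw [hne] at this
    simp [wCoeff] at this) hcard
  have haT' : ∀ m, α (a m) 1 ≠ 0 := fun m => (Finset.mem_filter.1 (haT m)).2
  refine not_relation_of_sum_four (fun m => α' (a m)) (fun m => β' (a m)) (fun m => γ' (a m))
    (fun m => ε m * (α (a m) 1 * β (a m) 1 * γ (a m) 0)) (fun m => β (a m) 0 / β (a m) 1)
    (hC _ (haT' 0)).2 (fun i j k => ?_) fun i j k => ?_
  · have := hT 1 i j k
    rw [hε] at this
    simp [wCoeff] at this
    rw [← this]
    exact Finset.sum_congr rfl fun m _ => by ring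
  · have := hT 0 i j k
    rw [hε] at this
    rw [show wCoeff 1 0 0 = 1 by simp [wCoeff], one_mul] at this
    rw [← this]
    refine Finset.sum_congr rfl fun m _ => ?_
    have := hβ _ (haT' m)
    field_simp

theorem ne_zero_of_support (h : WWDecomposition α β γ α' β' γ') (hι : Fintype.card ι ≤ 7)
    (hT : ∀ l, β l 1 ≠ 0 ∧ β' l 1 ≠ 0 → γ' l 1 ≠ 0 ∧ α' l 1 ≠ 0) (l : ι) (hl : α l 1 ≠ 0) :
    α' l 1 ≠ 0 := fun hl' =>
  (hT l (h.subset_support hι (fun j hj => (hT j hj).1) hl hl')).2 hl'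

theorem false_of_support_third (h : WWDecomposition α β γ α' β' γ') (hι : Fintype.card ι ≤ 7)
    {l₀ : ι} (hl₀ : α l₀ 1 ≠ 0 ∧ α' l₀ 1 ≠ 0)
    (hAB : ∀ j, α j 1 ≠ 0 ∧ α' j 1 ≠ 0 ↔ β j 1 ≠ 0 ∧ β' j 1 ≠ 0)
    (hC : ∀ j, α j 1 ≠ 0 ∧ α' j 1 ≠ 0 → γ j 1 = 0 ∧ γ' j 1 ≠ 0) : False := by
  have hA : ∀ l, α l 1 ≠ 0 → α' l 1 ≠ 0 := fun l hl hl' =>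
    ((hAB l).2 (h.opposite_side hι (hC l₀ hl₀).2 (hC l₀ hl₀).1 hl hl' ((hAB l₀).1 hl₀))).2 hl'
  exact h.not_disjoint_third hι (fun l hl => ((hAB l).1 ⟨hl, hA l hl⟩).1)
    fun l hl => ⟨(hC l ⟨hl, hA l hl⟩).1, hA l hl⟩

/-- Supports that meet coincide, and γ and γ' at coordinate 1 each vanish everywhere or nowhere on
them. The four cases end in `not_all_supports_eq`, `false_of_support_third` (twice) and
`not_disjoint`. -/
theorem supports_disjoint (h : WWDecomposition α β γ α' β' γ') (hι : Fintype.card ι ≤ 7)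
    {l₀ : ι} (hA : α l₀ 1 ≠ 0 ∧ α' l₀ 1 ≠ 0) (hB : β l₀ 1 ≠ 0 ∧ β' l₀ 1 ≠ 0) : False := by
  have hAB := h.support_iff hι hA hB
  have h4 : ∀ j, γ j 1 ≠ 0 → (α j 1 ≠ 0 ∧ α' j 1 ≠ 0) →
      ∀ j, α j 1 ≠ 0 ∧ α' j 1 ≠ 0 → γ j 1 ≠ 0 := fun j hj hjT i hi =>
    ((h.swap₁₂.swap₂₃.swap₁₂.support_iff hι ⟨hj, hjT.2⟩ ((hAB j).1 hjT) i).2 ((hAB i).1 hi)).1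
  have h4' : ∀ j, γ' j 1 ≠ 0 → (α j 1 ≠ 0 ∧ α' j 1 ≠ 0) →
      ∀ j, α j 1 ≠ 0 ∧ α' j 1 ≠ 0 → γ' j 1 ≠ 0 := fun j hj hjT i hi =>
    ((h.swap₁₂'.swap₂₃'.swap₁₂'.support_iff hι ⟨hjT.1, hj⟩ ((hAB j).1 hjT) i).2 ((hAB i).1 hi)).2
  by_cases hC : γ l₀ 1 ≠ 0 <;> by_cases hC' : γ' l₀ 1 ≠ 0
  · have hT := h4 l₀ hC hA
    have hT' := h4' l₀ hC' hA
    have hAC := h.swap₂₃.swap₂₃'.support_iff hι hA ⟨hC, hC'⟩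
    have hCB := h.swap₁₂.swap₂₃.swap₁₂.swap₁₂'.swap₂₃'.swap₁₂'
    have a1 := h.ne_zero_of_support hι fun l hl => ⟨hT' l ((hAB l).2 hl), ((hAB l).2 hl).2⟩
    have a2 := h.symm.ne_zero_of_support hι fun l hl =>
      ⟨hT l ((hAB l).2 hl.symm), ((hAB l).2 hl.symm).1⟩
    have b1 := h.swap₁₂.swap₁₂'.ne_zero_of_support hι fun l hl => ⟨hT' l hl, ((hAB l).1 hl).2⟩
    have b2 := h.swap₁₂.swap₁₂'.symm.ne_zero_of_support hι fun l hl =>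
      ⟨hT l hl.symm, ((hAB l).1 hl.symm).1⟩
    have c1 := hCB.ne_zero_of_support hι fun l hl => ⟨((hAB l).2 hl).2, hT' l ((hAB l).2 hl)⟩
    have c2 := hCB.symm.ne_zero_of_support hι fun l hl =>
      ⟨((hAB l).2 hl.symm).1, hT l ((hAB l).2 hl.symm)⟩
    refine h.not_all_supports_eq hι fun l => ?_
    by_cases hl : α l 1 ≠ 0
    · have hα' := a1 l hl
      have hβ := (hAB l).1 ⟨hl, hα'⟩
      have hγ := (hAC l).1 ⟨hl, hα'⟩
      exact .inl ⟨hl, hβ.1, hγ.1, hα', hβ.2, hγ.2⟩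
    · have hα' : ¬ α' l 1 ≠ 0 := fun h => hl (a2 l h)
      have hβ : ¬ β l 1 ≠ 0 := fun h => hl ((hAB l).2 ⟨h, b1 l h⟩).1
      have hβ' : ¬ β' l 1 ≠ 0 := fun h => hβ (b2 l h)
      have hγ : ¬ γ l 1 ≠ 0 := fun h => hl ((hAC l).2 ⟨h, c1 l h⟩).1
      have hγ' : ¬ γ' l 1 ≠ 0 := fun h => hγ (c2 l h)
      push Not at hl hα' hβ hβ' hγ hγ'
      exact .inr ⟨hl, hβ, hγ, hα', hβ', hγ'⟩
  · refine h.symm.false_of_support_third hι hA.symm (fun j => ?_) fun j hj => ?_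
    · have := hAB j; tauto
    · refine ⟨?_, h4 l₀ hC hA j hj.symm⟩
      by_contra hne
      exact hC' (h4' j hne hj.symm l₀ hA)
  · refine h.false_of_support_third hι hA hAB fun j hj => ⟨?_, h4' l₀ hC' hA j hj⟩
    by_contra hne
    exact hC (h4 j hne hj l₀ hA)
  · refine h.not_disjoint hι fun j hj => ?_
    rw [← hAB j] at hj
    refine ⟨?_, ?_, hj.2⟩ <;> by_contra hne
    · exact hC (h4 j hne hj l₀ hA)
    · exact hC' (h4' j hne hj l₀ hA)

/-- This extends `supports_disjoint` to pairs sharing a factor: a counterexample forces a summand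
`m` in the supports of both α ⊗ α' and γ ⊗ γ'. -/
theorem eq_zero_of_support (h : WWDecomposition α β γ α' β' γ') (hι : Fintype.card ι ≤ 7)
    {l : ι} (hl : β l 1 ≠ 0 ∧ β' l 1 ≠ 0) : α l 1 = 0 := by
  by_contra hα
  have hAC := h.swap₂₃'
  have hCA := h.swap₁₂.swap₂₃.swap₁₂
  have hCC := hCA.swap₁₂'.swap₂₃'.swap₁₂'
  have hAC' : WWDecomposition α β γ γ' β' α' := h.swap₁₂'.swap₂₃'.swap₁₂'
  have dA : ∀ j, β j 1 ≠ 0 ∧ β' j 1 ≠ 0 → ¬ (α j 1 ≠ 0 ∧ α' j 1 ≠ 0) := fun j hj hj' =>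
    h.supports_disjoint hι hj' hj
  have dAC : ∀ j, β j 1 ≠ 0 ∧ β' j 1 ≠ 0 → ¬ (α j 1 ≠ 0 ∧ γ' j 1 ≠ 0) := fun j hj hj' =>
    hAC'.supports_disjoint hι hj' hj
  have dCA : ∀ j, β j 1 ≠ 0 ∧ β' j 1 ≠ 0 → ¬ (γ j 1 ≠ 0 ∧ α' j 1 ≠ 0) := fun j hj hj' =>
    hCA.supports_disjoint hι hj' hj
  have hlA' : α' l 1 = 0 := by have := dA l hl; tauto
  have hlC' : γ' l 1 = 0 := by have := dAC l hl; tauto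
  obtain ⟨j, hj, hjA'⟩ := hAC'.exists_support hι hα hlC' hl
  have hjA : α j 1 = 0 := by have := dA j hj; tauto
  have hjC : γ j 1 = 0 := by have := dCA j hj; tauto
  obtain ⟨m, hm⟩ := h.swap₁₂.swap₁₂'.exists_ne_zero
  have hmB : ¬ (β m 1 ≠ 0 ∧ β' m 1 ≠ 0) := fun hmB => dA m hmB hm
  have hmC' : γ' m 1 ≠ 0 := fun h0 => hmB (hAC'.same_side hι hα hlC' hm.1 h0 hl)
  have hmC : γ m 1 ≠ 0 := fun h0 =>
    hmB (hCA.symm.same_side hι hjA' hjC hm.2 h0 hj.symm).symm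
  exact h.swap₂₃.swap₂₃'.supports_disjoint hι hm ⟨hmC, hmC'⟩

end WWDecomposition

/-! ### Counting the nine supports. -/

theorem exists_third {P : Fin 3 → Fin 3 → Fin 3 → Prop} (h : P 0 1 2)
    (h₁₂ : ∀ i j k, P i j k → P j i k) (h₂₃ : ∀ i j k, P i j k → P i k j) {i k : Fin 3}
    (hik : k ≠ i) : ∃ j, P k i j := by
  have p01 := h
  have p10 := h₁₂ _ _ _ h
  have p02 := h₂₃ _ _ _ h
  have p20 := h₁₂ _ _ _ p02
  have p12 := h₂₃ _ _ _ p10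
  have p21 := h₁₂ _ _ _ p12
  fin_cases i <;> fin_cases k <;> first | exact absurd rfl hik | exact ⟨_, by assumption⟩

theorem not_wwDecomposition {ι : Type*} [Fintype ι] (hι : Fintype.card ι ≤ 7)
    (φ φ' : Fin 3 → ι → Fin 2 → ℂ)
    (h : WWDecomposition (φ 0) (φ 1) (φ 2) (φ' 0) (φ' 1) (φ' 2)) : False := by
  have hP : ∀ i k, k ≠ i → ∃ j, WWDecomposition (φ k) (φ i) (φ j) (φ' 0) (φ' 1) (φ' 2) :=
    fun i k hik => exists_third (P := fun i j k =>
      WWDecomposition (φ i) (φ j) (φ k) (φ' 0) (φ' 1) (φ' 2)) h (fun _ _ _ h => h.swap₁₂)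
      (fun _ _ _ h => h.swap₂₃) hik
  have hP' : ∀ a b c, WWDecomposition (φ a) (φ b) (φ c) (φ' 0) (φ' 1) (φ' 2) →
      ∀ i k, k ≠ i → ∃ j, WWDecomposition (φ a) (φ b) (φ c) (φ' k) (φ' i) (φ' j) :=
    fun a b c h i k hik => exists_third (P := fun i j k =>
      WWDecomposition (φ a) (φ b) (φ c) (φ' i) (φ' j) (φ' k)) h (fun _ _ _ h => h.swap₁₂')
      (fun _ _ _ h => h.swap₂₃') hik
  have hne : ∀ x : Fin 3 × Fin 3, ∃ l, φ x.1 l 1 ≠ 0 ∧ φ' x.2 l 1 ≠ 0 := by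
    rintro ⟨i, i'⟩
    obtain ⟨k, hk⟩ := exists_ne i
    obtain ⟨k', hk'⟩ := exists_ne i'
    obtain ⟨j, hj⟩ := hP i k hk
    obtain ⟨j', hj'⟩ := hP' _ _ _ hj i' k' hk'
    exact hj'.exists_ne_zero
  choose m hm using hne
  have hinj : Function.Injective m := by
    rintro ⟨i, i'⟩ ⟨k, k'⟩ hik
    have h1 := hm (i, i')
    have h2 := hm (k, k')
    rw [← hik] at h2
    ext1
    · by_contra hne
      obtain ⟨j, hj⟩ := hP i k (Ne.symm hne)
      obtain ⟨n, hn⟩ := exists_ne i'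
      obtain ⟨j', hj'⟩ := hP' _ _ _ hj i' n hn
      exact h2.1 (hj'.eq_zero_of_support hι h1)
    · by_contra hne
      obtain ⟨n, hn⟩ := exists_ne i
      obtain ⟨j, hj⟩ := hP i n hn
      obtain ⟨j', hj'⟩ := hP' _ _ _ hj i' k' (Ne.symm hne)
      exact h2.2 (hj'.symm.eq_zero_of_support hι h1.symm)
  have := Fintype.card_le_of_injective m hinj
  simp at this
  omega

/-! ### Return to tensors and the eight-term decomposition. -/

/-- The basis of a tensor power of `ℂ²` that is induced by the standard basis. -/
noncomputable def qubitBasis (n : ℕ) :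
    Module.Basis (Fin n → Fin 2) ℂ (⨂[ℂ]^n (Fin 2 → ℂ)) :=
  Basis.piTensorProduct fun _ => Pi.basisFun ℂ (Fin 2)

theorem qubitBasis_repr_tprod {n : ℕ} (x : Fin n → Fin 2 → ℂ) (p : Fin n → Fin 2) :
    (qubitBasis n).repr (PiTensorProduct.tprod ℂ x) p = ∏ i, x i (p i) := by
  simp [qubitBasis, Basis.piTensorProduct_repr_tprod_apply]

theorem outerProduct_tprod {m n : ℕ} (x : Fin m → Fin 2 → ℂ) (y : Fin n → Fin 2 → ℂ) :
    outerProduct (PiTensorProduct.tprod ℂ x) (PiTensorProduct.tprod ℂ y) =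
      PiTensorProduct.tprod ℂ (Fin.append x y) :=
  TensorPower.tprod_mul_tprod ℂ x y

theorem qubitBasis_repr_wTensor (p : Fin 3 → Fin 2) :
    (qubitBasis 3).repr (wTensor 3) p = wCoeff (p 0) (p 1) (p 2) := by
  simp only [wTensor, map_sum, Finsupp.coe_finsetSum, Finset.sum_apply, qubitBasis_repr_tprod]
  simp only [Fin.sum_univ_three, Fin.prod_univ_three]
  generalize p 0 = i
  generalize p 1 = j
  generalize p 2 = k
  fin_cases i <;> fin_cases j <;> fin_cases k <;> simp [wCoeff]

theorem qubitBasis_repr_outerProduct (p : Fin (3 + 3) → Fin 2) :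
    (qubitBasis (3 + 3)).repr (outerProduct (wTensor 3) (wTensor 3)) p =
      wCoeff (p 0) (p 1) (p 2) * wCoeff (p 3) (p 4) (p 5) := by
  have h1 := qubitBasis_repr_wTensor fun i => p (Fin.castAdd 3 i)
  have h2 := qubitBasis_repr_wTensor fun i => p (Fin.natAdd 3 i)
  have h3 : outerProduct (wTensor 3) (wTensor 3) = ∑ i : Fin 3, ∑ j : Fin 3,
      PiTensorProduct.tprod ℂ (Fin.append
        (fun k : Fin 3 => if k = i then (Pi.single 1 1 : Fin 2 → ℂ) else Pi.single 0 1)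
        (fun k : Fin 3 => if k = j then (Pi.single 1 1 : Fin 2 → ℂ) else Pi.single 0 1)) := by
    simp only [← outerProduct_tprod]
    simp only [outerProduct, wTensor, TensorProduct.sum_tmul, TensorProduct.tmul_sum, map_sum]
    exact Finset.sum_comm
  rw [h3]
  simp only [wTensor, map_sum, Finsupp.coe_finsetSum, Finset.sum_apply,
    qubitBasis_repr_tprod] at h1 h2 ⊢
  refine Eq.trans ?_ (congrArg₂ (· * ·) h1 h2)
  rw [Finset.sum_mul_sum]
  refine Finset.sum_congr rfl fun i _ => Finset.sum_congr rfl fun j _ => ?_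
  rw [Fin.prod_univ_add]
  simp only [Fin.append_left, Fin.append_right]

theorem cube_add_cube (s : ℂ) (i j k : Fin 2) :
    (![s, 1] i * ![s, 1] j * ![s, 1] k : ℂ) + ![-s, 1] i * ![-s, 1] j * ![-s, 1] k =
      2 * s ^ 2 * wCoeff i j k + 2 * (![0, 1] i * ![0, 1] j * ![0, 1] k) := by
  fin_cases i <;> fin_cases j <;> fin_cases k <;> simp [wCoeff] <;> ring

theorem hasProductDecomposition_eight :
    HasProductDecomposition (outerProduct (wTensor 3) (wTensor 3)) 8 := by
  -- The four terms (±1, ±1) give (W + C)(W' + C'), with C, C' the cubes of e₁. The other pairs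
  -- remove the cross terms, and C C' cancels because 1/(5/4)² + 1/(5/3)² = 16/25 + 9/25 = 1.
  let s : Fin 8 → ℂ := ![1, 1, -1, -1, 0, 0, 5 / 4, -(5 / 4)]
  let t : Fin 8 → ℂ := ![1, -1, 1, -1, 5 / 3, -(5 / 3), 0, 0]
  refine ⟨![1 / 4, 1 / 4, 1 / 4, 1 / 4, -9 / 50, -9 / 50, -8 / 25, -8 / 25],
    fun l => Fin.append (fun _ : Fin 3 => ![s l, 1]) (fun _ : Fin 3 => ![t l, 1]), ?_⟩
  refine (qubitBasis (3 + 3)).ext_elem fun p => ?_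
  rw [qubitBasis_repr_outerProduct]
  simp only [map_sum, map_smul, Finsupp.coe_finsetSum, Finset.sum_apply, Finsupp.smul_apply,
    qubitBasis_repr_tprod, Fin.prod_univ_add, Fin.append_left, Fin.append_right,
    Fin.prod_univ_three, smul_eq_mul]
  have e0 : Fin.castAdd 3 (0 : Fin 3) = 0 := rfl
  have e1 : Fin.castAdd 3 (1 : Fin 3) = 1 := rfl
  have e2 : Fin.castAdd 3 (2 : Fin 3) = 2 := rfl
  have e3 : Fin.natAdd 3 (0 : Fin 3) = 3 := rfl
  have e4 : Fin.natAdd 3 (1 : Fin 3) = 4 := rfl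
  have e5 : Fin.natAdd 3 (2 : Fin 3) = 5 := rfl
  rw [e0, e1, e2, e3, e4, e5]
  obtain ⟨c, hc⟩ : ∃ c : ℂ → ℂ, ∀ z, ![z, 1] (p 0) * ![z, 1] (p 1) * ![z, 1] (p 2) = c z :=
    ⟨_, fun _ => rfl⟩
  obtain ⟨d, hd⟩ : ∃ d : ℂ → ℂ, ∀ z, ![z, 1] (p 3) * ![z, 1] (p 4) * ![z, 1] (p 5) = d z :=
    ⟨_, fun _ => rfl⟩
  have hc' := fun z => cube_add_cube z (p 0) (p 1) (p 2)
  have hd' := fun z => cube_add_cube z (p 3) (p 4) (p 5)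
  simp only [hc, hd] at hc' hd' ⊢
  simp only [Fin.sum_univ_eight, s, t]
  simp
  have c1 := hc' 1
  have c2 := hc' (5 / 4)
  have d1 := hd' 1
  have d2 := hd' (5 / 3)
  generalize wCoeff (p 0) (p 1) (p 2) = w at *
  generalize wCoeff (p 3) (p 4) (p 5) = w' at *
  linear_combination (-1 / 4) * (d 1 + d (-1)) * c1 - (1 / 2) * (w + c 0) * d1 +
    (9 / 50) * c 0 * d2 + (8 / 25) * d 0 * c2

theorem not_hasProductDecomposition {r : ℕ} (hr : r ≤ 7) :
    ¬ HasProductDecomposition (outerProduct (wTensor 3) (wTensor 3)) r := by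
  rintro ⟨a, x, hT⟩
  have hcoord : ∀ p : Fin (3 + 3) → Fin 2, ∑ l, a l * ∏ i, x l i (p i) =
      wCoeff (p 0) (p 1) (p 2) * wCoeff (p 3) (p 4) (p 5) := by
    intro p
    rw [← qubitBasis_repr_outerProduct, hT]
    simp [qubitBasis_repr_tprod]
  classical
  -- Vanishing summands are dropped, and each scalar is absorbed into the first vector.
  let N := {l : Fin r // ∀ i, a l • x l 0 ≠ 0 ∧ x l i ≠ 0}
  have hN : Fintype.card N ≤ 7 := (Fintype.card_subtype_le _).trans (by simpa using hr)
  refine not_wwDecomposition hN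
    ![fun l => a l.1 • x l.1 0, fun l => x l.1 1, fun l => x l.1 2]
    ![fun l => x l.1 3, fun l => x l.1 4, fun l => x l.1 5] ⟨fun i j k i' j' k' => ?_, fun l => ?_⟩
  · have h1 := hcoord ![i, j, k, i', j', k']
    have h2 : ∀ l, a l * ∏ m, x l m (![i, j, k, i', j', k'] m) =
        (a l • x l 0) i * x l 1 j * x l 2 k * x l 3 i' * x l 4 j' * x l 5 k' := by
      intro l
      rw [show (∏ m, x l m (![i, j, k, i', j', k'] m)) = x l 0 i * x l 1 j * x l 2 k * x l 3 i' *
        x l 4 j' * x l 5 k' from Fin.prod_univ_six _, Pi.smul_apply, smul_eq_mul]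
      ring
    rw [Finset.sum_congr rfl fun l _ => h2 l] at h1
    refine Eq.trans ?_ h1
    refine Fintype.sum_of_injective Subtype.val Subtype.val_injective _ _ (fun l hl => ?_)
      fun _ => rfl
    by_contra hne
    simp only [mul_eq_zero, not_or] at hne
    obtain ⟨⟨⟨⟨⟨n0, n1⟩, n2⟩, n3⟩, n4⟩, n5⟩ := hne
    have n0' : a l • x l 0 ≠ 0 := fun h => n0 (congrFun h i)
    refine hl ⟨⟨l, fun m => ⟨n0', fun h => ?_⟩⟩, rfl⟩
    fin_cases m
    exacts [n0' (by rw [show x l 0 = 0 from h, smul_zero]), n1 (congrFun h j), n2 (congrFun h k),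
      n3 (congrFun h i'), n4 (congrFun h j'), n5 (congrFun h k')]
  · have h0 := l.2
    exact ⟨(h0 0).1, (h0 1).2, (h0 2).2, (h0 3).2, (h0 4).2, (h0 5).2⟩

theorem mainTheorem6 : tensorRank (outerProduct (wTensor 3) (wTensor 3)) = 8 := by
  refine (tensorRank_isLeast _).unique ⟨hasProductDecomposition_eight, fun r hr => ?_⟩
  by_contra! hlt
  exact not_hasProductDecomposition (by omega) hr
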